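/- **Theorem 1.7.** Let $n\ge 3$, $m\ge 1$, let $(\mathbb R^n,g)$ be the pseudo-Euclidean space with coordinates $x=(x_1,\dots,x_n)$ and $g_{ij}=\delta_{ij}\varepsilon_i$, $\varepsilon_i=\pm1$, and let $(F^m,g_F)$ be a (nonempty, smooth) Ricci-flat semi-Riemannian manifold of dimension $m$. Let $\alpha_1,\dots,\alpha_n\in\mathbb R$ with $\sum_{i=1}^n\varepsilon_i\alpha_i^2=0$, and put $\xi=\sum_{i=1}^n\alpha_ix_i$. Let $\varphi,f:\mathbb R\to\mathbb R$ be arbitrary positive smooth functions, and let $$h(\xi)=\int\varphi^{-2}\left[\int\left(m\frac{f''}{f}\varphi^2+2m\varphi\varphi'\frac{f'}{f}-(n-2)\varphi\varphi''\right)d\xi+c_4\right]d\xi+c_5,\qquad c_4,c_5\in\mathbb R,$$ where $c_4,c_5$ are arbitrary and the two indefinite integrals are taken from arbitrary base points. Then $h$ is a smooth function on $\mathbb R$ that satisfies $$(n-2)f\varphi''+f\varphi h''-m\varphi f''-2m\varphi'f'+2f\varphi'h'=0,$$ and the warped product $M=(\mathbb R^n,\bar g)\times_fF^m$ with $\bar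 g=\varphi(\xi)^{-2}g$, that is, $\mathbb R^n\times F$ with the metric $\tilde g=\varphi(\xi)^{-2}g+f(\xi)^2g_F$, is a steady gradient Ricci soliton with potential function $h(\xi)$: $\tilde g$ is a semi-Riemannian metric and $\mathrm{Ric}_{\tilde g}+\mathrm{Hess}_{\tilde g}(h)=0$. In particular, for each such $\alpha$ and $(F,g_F)$ there are infinitely many metrics of the form $\varphi(\xi)^{-2}g+f(\xi)^2g_F$, with $\varphi,f$ positive and smooth, that are steady gradient Ricci solitons on $\mathbb R^n\times F$ with a smooth potential function of the form $h(\xi)$. -/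

import Mathlib

open scoped Manifold ContDiff

set_option maxSynthPendingDepth 3

noncomputable section

/-! ### Curvature of a metric in coordinates

Here `G : E → E →L[ℝ] E →L[ℝ] ℝ` is the coordinate expression of a metric on (an open part of) a
finite-dimensional real vector space `E`: `G x u v` is the product of `u` and `v` at `x`. -/

section Coordinates

variable {E : Type*} [NormedAddCommGroup E] [NormedSpace ℝ E]

/-- The Koszul form `K(u, v, w) = ½ (∂_u G(v, w) + ∂_v G(u, w) - ∂_w G(u, v))`, that is, the
Christoffel symbols of the first kind. -/
def koszulForm (G : E → E →L[ℝ] E →L[ℝ] ℝ) (x : E) : E →L[ℝ] E →L[ℝ] E →L[ℝ] ℝ :=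
  (1 / 2 : ℝ) • (fderiv ℝ G x + (fderiv ℝ G x).flip -
    ((ContinuousLinearMap.flipₗᵢ ℝ E E ℝ : (E →L[ℝ] E →L[ℝ] ℝ) →L[ℝ] (E →L[ℝ] E →L[ℝ] ℝ)) ∘L
      (fderiv ℝ G x).flip))

theorem koszulForm_apply (G : E → E →L[ℝ] E →L[ℝ] ℝ) (x u v w : E) :
    koszulForm G x u v w =
      1 / 2 * (fderiv ℝ G x u v w + fderiv ℝ G x v u w - fderiv ℝ G x w u v) := by
  simp [koszulForm]

/-- The Christoffel map `Γ(u, v)` of the Levi-Civita connection: the vector with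
`G(Γ(u, v), w) = K(u, v, w)` for all `w`. For a nondegenerate `G x`, seen as a map from `E` to its
dual, `(G x).inverse` is the inverse map. In a basis, `Γ(e_i, e_j) = ∑ k, Γ_{ij}^k e_k`. -/
def christoffel (G : E → E →L[ℝ] E →L[ℝ] ℝ) (x : E) : E →L[ℝ] E →L[ℝ] E :=
  (ContinuousLinearMap.compL ℝ E (E →L[ℝ] ℝ) E (G x).inverse) ∘L (koszulForm G x)

theorem christoffel_apply (G : E → E →L[ℝ] E →L[ℝ] ℝ) (x u v : E) :
    christoffel G x u v = (G x).inverse (koszulForm G x u v) := rfl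

/-- The curvature endomorphism `u ↦ R(u, v) w` with
`R(u, v) w = ∂_u Γ(v, w) - ∂_v Γ(u, w) + Γ(u, Γ(v, w)) - Γ(v, Γ(u, w))`,
which is `∇_u ∇_v w - ∇_v ∇_u w` for constant vector fields `u, v, w`. -/
def coordCurvature (G : E → E →L[ℝ] E →L[ℝ] ℝ) (x v w : E) : E →ₗ[ℝ] E where
  toFun u := fderiv ℝ (christoffel G) x u v w - fderiv ℝ (christoffel G) x v u w
    + christoffel G x u (christoffel G x v w) - christoffel G x v (christoffel G x u w)
  map_add' a b := by
    simp only [map_add, add_apply]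
    abel
  map_smul' c a := by
    simp only [map_smul, smul_apply, RingHom.id_apply, smul_add, smul_sub]

/-- The Ricci tensor in coordinates, `Ric(v, w) = tr (u ↦ R(u, v) w)`. -/
def coordRicci (G : E → E →L[ℝ] E →L[ℝ] ℝ) (x v w : E) : ℝ :=
  LinearMap.trace ℝ E (coordCurvature G x v w)

/-- The Hessian in coordinates, `Hess k (u, v) = ∂_u ∂_v k - dk (Γ(u, v))`. -/
def coordHessian (G : E → E →L[ℝ] E →L[ℝ] ℝ) (k : E → ℝ) (x u v : E) : ℝ :=
  fderiv ℝ (fderiv ℝ k) x u v - fderiv ℝ k x (christoffel G x u v)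

end Coordinates

/-! ### Semi-Riemannian manifolds

`M` is a smooth manifold without boundary, modelled on the finite-dimensional vector space `E`. -/

section Manifold

/-- The pullback `(u, v) ↦ B (A u, A v)` of a bilinear form under a linear map. -/
def pullbackForm {V W : Type*} [AddCommGroup V] [Module ℝ V] [TopologicalSpace V]
    [IsTopologicalAddGroup V] [ContinuousSMul ℝ V] [AddCommGroup W] [Module ℝ W]
    [TopologicalSpace W] [IsTopologicalAddGroup W] [ContinuousSMul ℝ W]
    (B : V →L[ℝ] V →L[ℝ] ℝ) (A : W →L[ℝ] V) : W →L[ℝ] W →L[ℝ] ℝ :=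
  (ContinuousLinearMap.precomp ℝ A) ∘L B ∘L A

theorem pullbackForm_apply {V W : Type*} [AddCommGroup V] [Module ℝ V] [TopologicalSpace V]
    [IsTopologicalAddGroup V] [ContinuousSMul ℝ V] [AddCommGroup W] [Module ℝ W]
    [TopologicalSpace W] [IsTopologicalAddGroup W] [ContinuousSMul ℝ W]
    (B : V →L[ℝ] V →L[ℝ] ℝ) (A : W →L[ℝ] V) (u v : W) :
    pullbackForm B A u v = B (A u) (A v) := rfl

variable {E : Type*} [NormedAddCommGroup E] [NormedSpace ℝ E]
  {H : Type*} [TopologicalSpace H] (I : ModelWithCorners ℝ E H)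
  (M : Type*) [TopologicalSpace M] [ChartedSpace H M]

/-- Fields of bilinear forms on the tangent spaces of `M`. -/
abbrev BilinField : Type _ := ∀ p : M, TangentSpace I p →L[ℝ] TangentSpace I p →L[ℝ] ℝ

variable {I M}

/-- The expression of `g` in the preferred chart `ψ` at `p`, that is, the pullback of `g` under
`ψ⁻¹`: `(y; u, v) ↦ g_{ψ⁻¹ y} (D ψ⁻¹_y u, D ψ⁻¹_y v)`. -/
def BilinField.inChart (g : BilinField I M) (p : M) (y : E) : E →L[ℝ] E →L[ℝ] ℝ :=
  pullbackForm (g ((extChartAt I p).symm y)) (mfderiv 𝓘(ℝ, E) I (extChartAt I p).symm y)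

/-- `g` is a semi-Riemannian metric: symmetric, nondegenerate, with smooth coefficients in the
charts. No signature is prescribed. -/
structure IsSemiRiemannianMetric (g : BilinField I M) : Prop where
  symm : ∀ p u v, g p u v = g p v u
  nondegenerate : ∀ p u, (∀ v, g p u v = 0) → u = 0
  smooth : ∀ p, ContDiffOn ℝ ∞ (g.inChart p) (extChartAt I p).target

/-- The Ricci tensor of `g` at `p`, computed in the preferred chart at `p`. By definition
`TangentSpace I p` is `E`, and a tangent vector at `p` is identified with its coordinate vector in
that chart. -/
def ricci (g : BilinField I M) (p : M) (u v : TangentSpace I p) : ℝ :=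
  coordRicci (g.inChart p) (extChartAt I p p) u v

/-- The Hessian of `k : M → ℝ` with respect to `g` at `p`, computed in the preferred chart at
`p`. -/
def hessian (g : BilinField I M) (k : M → ℝ) (p : M) (u v : TangentSpace I p) : ℝ :=
  coordHessian (g.inChart p) (k ∘ (extChartAt I p).symm) (extChartAt I p p) u v

/-- `g` is Ricci-flat. -/
def IsRicciFlat (g : BilinField I M) : Prop := ∀ p u v, ricci g p u v = 0

/-- `(M, g)` is a gradient Ricci soliton with potential `k` and constant `ρ`:
`Ric_g + Hess_g k = ρ g`. -/
structure IsGradientRicciSoliton (g : BilinField I M) (k : M → ℝ) (ρ : ℝ) : Prop where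
  metric : IsSemiRiemannianMetric g
  smooth : ContMDiff I 𝓘(ℝ, ℝ) ∞ k
  equation : ∀ p u v, ricci g p u v + hessian g k p u v = ρ * g p u v

/-- A gradient Ricci soliton is steady if `ρ = 0`. -/
def IsSteadyGradientRicciSoliton (g : BilinField I M) (k : M → ℝ) : Prop :=
  IsGradientRicciSoliton g k 0

/-- The conformal metric `φ⁻² g`. -/
def BilinField.conformal (g : BilinField I M) (φ : M → ℝ) : BilinField I M :=
  fun p => (φ p ^ 2)⁻¹ • g p

variable {E' : Type*} [NormedAddCommGroup E'] [NormedSpace ℝ E']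
  {H' : Type*} [TopologicalSpace H'] {I' : ModelWithCorners ℝ E' H'}
  {F : Type*} [TopologicalSpace F] [ChartedSpace H' F]

/-- The warped product metric `π₁^* g_B + (f ∘ π₁)² π₂^* g_F` on the product of the base `M` and
the fibre `F`. -/
def warpedProduct (gB : BilinField I M) (f : M → ℝ) (gF : BilinField I' F) :
    BilinField (I.prod I') (M × F) :=
  fun p =>
    pullbackForm (gB p.1) (mfderiv (I.prod I') I Prod.fst p) +
      f p.1 ^ 2 • pullbackForm (gF p.2) (mfderiv (I.prod I') I' Prod.snd p)

end Manifold

/-! ### Pseudo-Euclidean space and the data of the theorem -/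

/-- The pseudo-Euclidean metric `g_{ij} = δ_{ij} ε_i` on `ℝⁿ`. -/
def pseudoEuclidean {n : ℕ} (ε : Fin n → ℝ) : BilinField (𝓡 n) (EuclideanSpace ℝ (Fin n)) :=
  fun _ => ∑ i, ε i • (EuclideanSpace.proj i : EuclideanSpace ℝ (Fin n) →L[ℝ] ℝ).smulRight
    (EuclideanSpace.proj i : EuclideanSpace ℝ (Fin n) →L[ℝ] ℝ)

theorem pseudoEuclidean_apply {n : ℕ} (ε : Fin n → ℝ) (x u v : EuclideanSpace ℝ (Fin n)) :
    pseudoEuclidean ε x u v = ∑ i, ε i * (u i * v i) := by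
  change (∑ i, ε i • (EuclideanSpace.proj i : EuclideanSpace ℝ (Fin n) →L[ℝ] ℝ).smulRight
    (EuclideanSpace.proj i : EuclideanSpace ℝ (Fin n) →L[ℝ] ℝ)) u v = _
  simp

/-- The invariant `ξ = ∑ i, α_i x_i`. -/
def xiInv {n : ℕ} (α : Fin n → ℝ) (x : EuclideanSpace ℝ (Fin n)) : ℝ := ∑ i, α i * x i

/-- The warped product metric `φ(ξ)⁻² g + f(ξ)² g_F` on `ℝⁿ × F`. -/
def xiWarpedMetric {n m : ℕ} (ε α : Fin n → ℝ) (φ f : ℝ → ℝ)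
    {F : Type*} [TopologicalSpace F] [ChartedSpace (EuclideanSpace ℝ (Fin m)) F]
    (gF : BilinField (𝓡 m) F) :
    BilinField ((𝓡 n).prod (𝓡 m)) (EuclideanSpace ℝ (Fin n) × F) :=
  warpedProduct ((pseudoEuclidean ε).conformal (fun x => φ (xiInv α x)))
    (fun x => f (xiInv α x)) gF

/-- The differential equation
`(n-2) f φ'' + f φ h'' - m φ f'' - 2 m φ' f' + 2 f φ' h' = 0` on the real line. -/
def NullSolitonODE (n m : ℕ) (φ f h : ℝ → ℝ) : Prop :=
  ∀ t : ℝ, ((n : ℝ) - 2) * f t * deriv (deriv φ) t + f t * φ t * deriv (deriv h) t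
    - m * φ t * deriv (deriv f) t - 2 * m * deriv φ t * deriv f t
    + 2 * f t * deriv φ t * deriv h t = 0

/-- The double-integral formula
`h = ∫ φ⁻² [∫ (m (f''/f) φ² + 2 m φ φ' f'/f - (n-2) φ φ'') dξ + c₄] dξ + c₅`,
where the two indefinite integrals are normalized to vanish at the base points `a` (inner) and
`b` (outer). -/
def nullPotential (n m : ℕ) (φ f : ℝ → ℝ) (a b c₄ c₅ : ℝ) (t : ℝ) : ℝ :=
  (∫ s in b..t, (φ s ^ 2)⁻¹ *
    ((∫ r in a..s, (m * (deriv (deriv f) r / f r) * φ r ^ 2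
        + 2 * m * φ r * deriv φ r * (deriv f r / f r)
        - ((n : ℝ) - 2) * φ r * deriv (deriv φ) r)) + c₄)) + c₅

end

/-!
Write `p = φ'/φ` and `q = f'/f`, and let `N` be the gradient of `ξ` with respect to the flat metric
`A = ∑ i, ε_i dx_i²`. In the product chart at a point the warped metric is `φ(ξ)⁻² A + f(ξ)² K`,
where `K` is the coordinate expression of the fibre metric (`xiWarpedMetric_inChart`). Its
Christoffel map is (`christoffel_warpedForm`)

  `Γ(u, v)₁ = -p (ξ(u) v₁ + ξ(v) u₁ - A(u₁, v₁) N) - f f' φ² K(u₂, v₂) N`,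
  `Γ(u, v)₂ = q (ξ(u) v₂ + ξ(v) u₂) + Γ_K(u₂, v₂)`.

The condition `∑ i, ε_i α_i² = 0` says that `ξ(N) = 0`. On the base block, the curvature
`u ↦ R(u, v) w` is a combination of the identity and of maps `u ↦ ξ(u) Z` and `u ↦ A(u, c) N`, whose
traces are `ξ(Z)` and `ξ(c)`; the part of `Z` along `N`, which carries all the occurrences of
`A(v₁, w₁)` and `K(v₂, w₂)`, does not contribute. What is left
(`coordRicci_warpedForm`, `ricci_xiWarpedMetric`, `hessian_xiWarpedMetric`) is

  `Ric = ((n - 2) φ''/φ - m (f''/f + 2 p q)) ξ ⊗ ξ + Ric_K`,  `Hess h = (h'' + 2 p h') ξ ⊗ ξ`.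

If the fibre is Ricci-flat, `Ric + Hess h` is the left-hand side of the differential equation,
divided by `f φ`, times `ξ ⊗ ξ` (`isSteadyGradientRicciSoliton_xiWarpedMetric`). The equation is
linear of first order in `h'` with integrating factor `φ²`, which gives the double-integral formula
for `h` (`nullPotential_contDiff_and_ode`). Since `φ` and `f` are arbitrary, infinitely many metrics
arise; they can be told apart by their values on the base at `ξ = 0`, even when `α = 0`.
-/

noncomputable section

/-! ### Christoffel symbols and curvature in coordinates -/

section CoordinateGeometry

variable {E : Type*} [NormedAddCommGroup E] [NormedSpace ℝ E]

theorem isInvertible_of_nondegenerate [FiniteDimensional ℝ E]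
    {B : E →L[ℝ] E →L[ℝ] ℝ}
    (hB : ∀ u, (∀ v, B u v = 0) → u = 0) : B.IsInvertible := by
  have hinj : Function.Injective (B : E →ₗ[ℝ] E →L[ℝ] ℝ) := by
    rw [← LinearMap.ker_eq_bot, LinearMap.ker_eq_bot']
    intro u hu
    exact hB u fun v => by simpa using congrArg (fun T : E →L[ℝ] ℝ => T v) hu
  have hfin : Module.finrank ℝ E = Module.finrank ℝ (E →L[ℝ] ℝ) := by
    rw [← (LinearMap.toContinuousLinearMap : (E →ₗ[ℝ] ℝ) ≃ₗ[ℝ] (E →L[ℝ] ℝ)).finrank_eq]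
    exact (Subspace.dual_finrank_eq (K := ℝ) (V := E)).symm
  refine ⟨(LinearMap.linearEquivOfInjective _ hinj hfin).toContinuousLinearEquiv, ?_⟩
  ext u v
  rfl

theorem christoffel_eq_iff [FiniteDimensional ℝ E]
    {G : E → E →L[ℝ] E →L[ℝ] ℝ} {x : E}
    (hG : ∀ u, (∀ v, G x u v = 0) → u = 0) {u v z : E} :
    christoffel G x u v = z ↔ ∀ w, koszulForm G x u v w = G x z w := by
  rw [christoffel_apply, (isInvertible_of_nondegenerate hG).inverse_apply_eq,
    ContinuousLinearMap.ext_iff]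

theorem contDiffAt_christoffel [FiniteDimensional ℝ E]
    {G : E → E →L[ℝ] E →L[ℝ] ℝ} {x : E}
    (hs : ContDiffAt ℝ ∞ G x) (hG : ∀ u, (∀ v, G x u v = 0) → u = 0) :
    ContDiffAt ℝ ∞ (christoffel G) x := by
  have : CompleteSpace E := FiniteDimensional.complete ℝ E
  have hd : ContDiffAt ℝ ∞ (fderiv ℝ G) x := hs.fderiv_right (by simp)
  have hflip : ContDiffAt ℝ ∞ (fun y => (fderiv ℝ G y).flip) x :=
    (ContinuousLinearMap.flipₗᵢ ℝ E E (E →L[ℝ] ℝ)).contDiff.contDiffAt.comp x hd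
  have hk : ContDiffAt ℝ ∞ (koszulForm G) x := by
    change ContDiffAt ℝ ∞ (fun y => koszulForm G y) x
    unfold koszulForm
    exact ((hd.add hflip).sub (contDiffAt_const.clm_comp hflip)).const_smul (1 / 2 : ℝ)
  have hi : ContDiffAt ℝ ∞ (fun y => (G y).inverse) x :=
    (isInvertible_of_nondegenerate hG).contDiffAt_map_inverse.comp x hs
  exact (((ContinuousLinearMap.compL ℝ E (E →L[ℝ] ℝ) E).contDiff.contDiffAt).comp x hi).clm_comp hk

/-- The derivative of a metric that is symmetric near `x` is symmetric. -/
theorem fderiv_symm {G : E → E →L[ℝ] E →L[ℝ] ℝ} {x : E} (hd : DifferentiableAt ℝ G x)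
    (hs : ∀ᶠ y in nhds x, ∀ u v, G y u v = G y v u) (w u v : E) :
    fderiv ℝ G x w u v = fderiv ℝ G x w v u := by
  have key : ∀ u v, HasFDerivAt (fun y => G y u v) (((fderiv ℝ G x).flip u).flip v) x := by
    intro u v
    have := (hd.hasFDerivAt.clm_apply (hasFDerivAt_const u x)).clm_apply (hasFDerivAt_const v x)
    refine this.congr_fderiv ?_
    ext w
    simp
  have := (key u v).unique ((key v u).congr_of_eventuallyEq (hs.mono fun y hy => hy u v))
  simpa using congrArg (fun T : E →L[ℝ] ℝ => T w) this

theorem christoffel_symm {G : E → E →L[ℝ] E →L[ℝ] ℝ} {x : E} (hd : DifferentiableAt ℝ G x)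
    (hs : ∀ᶠ y in nhds x, ∀ u v, G y u v = G y v u) (u v : E) :
    christoffel G x u v = christoffel G x v u := by
  rw [christoffel_apply, christoffel_apply]
  congr 1
  ext w
  rw [koszulForm_apply, koszulForm_apply, fderiv_symm hd hs w u v]
  ring

theorem koszulForm_congr {G G' : E → E →L[ℝ] E →L[ℝ] ℝ} {x : E} (h : G =ᶠ[nhds x] G') :
    koszulForm G x = koszulForm G' x := by
  rw [koszulForm, koszulForm, h.fderiv_eq]

theorem christoffel_congr {G G' : E → E →L[ℝ] E →L[ℝ] ℝ} {x : E} (h : G =ᶠ[nhds x] G') :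
    christoffel G =ᶠ[nhds x] christoffel G' := by
  filter_upwards [h.eventuallyEq_nhds] with y hy
  rw [christoffel, christoffel, koszulForm_congr hy, hy.eq_of_nhds]

theorem coordRicci_congr {G G' : E → E →L[ℝ] E →L[ℝ] ℝ} {x : E} (h : G =ᶠ[nhds x] G') (v w : E) :
    coordRicci G x v w = coordRicci G' x v w := by
  have h1 := christoffel_congr h
  have : coordCurvature G x v w = coordCurvature G' x v w := by
    ext u
    simp only [coordCurvature, LinearMap.coe_mk, AddHom.coe_mk, h1.fderiv_eq, h1.eq_of_nhds]
  rw [coordRicci, coordRicci, this]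

theorem coordHessian_congr {G G' : E → E →L[ℝ] E →L[ℝ] ℝ} {x : E} (h : G =ᶠ[nhds x] G')
    (k : E → ℝ) (v w : E) :
    coordHessian G k x v w = coordHessian G' k x v w := by
  rw [coordHessian, coordHessian, (christoffel_congr h).eq_of_nhds]

end CoordinateGeometry

theorem LinearMap.trace_prod_eq_add {V W : Type*} [AddCommGroup V] [Module ℝ V] [AddCommGroup W]
    [Module ℝ W] [FiniteDimensional ℝ V] [FiniteDimensional ℝ W] (T : V × W →ₗ[ℝ] V × W) :
    LinearMap.trace ℝ (V × W) T =
      LinearMap.trace ℝ V (LinearMap.fst ℝ V W ∘ₗ T ∘ₗ LinearMap.inl ℝ V W) +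
        LinearMap.trace ℝ W (LinearMap.snd ℝ V W ∘ₗ T ∘ₗ LinearMap.inr ℝ V W) := by
  rw [LinearMap.trace_comp_comm' (T ∘ₗ LinearMap.inl ℝ V W) (LinearMap.fst ℝ V W),
    LinearMap.trace_comp_comm' (T ∘ₗ LinearMap.inr ℝ V W) (LinearMap.snd ℝ V W), ← map_add]
  congr 1
  refine LinearMap.ext fun u => ?_
  simp only [LinearMap.add_apply, LinearMap.comp_apply, LinearMap.fst_apply, LinearMap.snd_apply,
    LinearMap.inl_apply, LinearMap.inr_apply, ← map_add]
  simp

/-! ### Warped forms and their Christoffel symbols -/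

section WarpedForm

variable {V : Type*} [NormedAddCommGroup V] [NormedSpace ℝ V]
  {W : Type*} [NormedAddCommGroup W] [NormedSpace ℝ W]

/-- The coordinate expression `φ(ξ)⁻² A + f(ξ)² K` on `V × W` of a warped product metric: `A` is a
constant form on the base `V`, `ξ` a linear form on `V`, and `K` the metric of the fibre in
coordinates. -/
def warpedForm (φ f : ℝ → ℝ) (ξ : V →L[ℝ] ℝ) (A : V →L[ℝ] V →L[ℝ] ℝ)
    (K : W → W →L[ℝ] W →L[ℝ] ℝ) (z : V × W) : V × W →L[ℝ] V × W →L[ℝ] ℝ :=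
  (φ (ξ z.1) ^ 2)⁻¹ • pullbackForm A (ContinuousLinearMap.fst ℝ V W) +
    f (ξ z.1) ^ 2 • pullbackForm (K z.2) (ContinuousLinearMap.snd ℝ V W)

variable {φ f : ℝ → ℝ} {ξ : V →L[ℝ] ℝ} {A : V →L[ℝ] V →L[ℝ] ℝ} {K : W → W →L[ℝ] W →L[ℝ] ℝ}

theorem warpedForm_apply (z u v : V × W) :
    warpedForm φ f ξ A K z u v =
      (φ (ξ z.1) ^ 2)⁻¹ * A u.1 v.1 + f (ξ z.1) ^ 2 * K z.2 u.2 v.2 := rfl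

theorem contDiffAt_warpedForm {z : V × W} (hφ : ContDiff ℝ ∞ φ) (hf : ContDiff ℝ ∞ f)
    (hφ0 : ∀ t, 0 < φ t) (hK : ContDiffAt ℝ ∞ K z.2) :
    ContDiffAt ℝ ∞ (warpedForm φ f ξ A K) z := by
  have hξ : ContDiffAt ℝ ∞ (fun z : V × W => ξ z.1) z :=
    ξ.contDiff.contDiffAt.comp z contDiffAt_fst
  have h1 : ContDiffAt ℝ ∞ (fun z : V × W => (φ (ξ z.1) ^ 2)⁻¹) z :=
    ((hφ.contDiffAt.comp z hξ).pow 2).inv (pow_pos (hφ0 _) 2).ne'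
  have h2 : ContDiffAt ℝ ∞ (fun z : V × W => f (ξ z.1) ^ 2) z :=
    (hf.contDiffAt.comp z hξ).pow 2
  have h3 : ContDiffAt ℝ ∞ (fun z : V × W => K z.2) z := hK.comp z contDiffAt_snd
  exact (h1.smul contDiffAt_const).add
    (h2.smul (contDiffAt_const.clm_comp (h3.clm_comp contDiffAt_const)))

theorem warpedForm_nondegenerate {z : V × W} (hφ0 : ∀ t, 0 < φ t) (hf0 : ∀ t, 0 < f t)
    (hA : ∀ u, (∀ v, A u v = 0) → u = 0) (hK : ∀ u, (∀ v, K z.2 u v = 0) → u = 0)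
    (u : V × W) (hu : ∀ v, warpedForm φ f ξ A K z u v = 0) : u = 0 := by
  have hφ' := (hφ0 (ξ z.1)).ne'
  have hf' := (hf0 (ξ z.1)).ne'
  refine Prod.ext (hA _ fun v => ?_) (hK _ fun v => ?_)
  · simpa [warpedForm_apply, hφ'] using hu (v, 0)
  · simpa [warpedForm_apply, hf'] using hu (0, v)

theorem fderiv_warpedForm {z : V × W} (hφ : ContDiff ℝ ∞ φ) (hf : ContDiff ℝ ∞ f)
    (hφ0 : ∀ t, 0 < φ t) (hK : ContDiffAt ℝ ∞ K z.2) (w u v : V × W) :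
    fderiv ℝ (warpedForm φ f ξ A K) z w u v =
      -(2 * deriv φ (ξ z.1) / φ (ξ z.1) ^ 3) * ξ w.1 * A u.1 v.1 +
        2 * f (ξ z.1) * deriv f (ξ z.1) * ξ w.1 * K z.2 u.2 v.2 +
        f (ξ z.1) ^ 2 * fderiv ℝ K z.2 w.2 u.2 v.2 := by
  have hφ' := (hφ0 (ξ z.1)).ne'
  have hd : HasFDerivAt (warpedForm φ f ξ A K) _ z :=
    ((contDiffAt_warpedForm hφ hf hφ0 hK).differentiableAt (by simp)).hasFDerivAt
  have h1 := (hd.clm_apply (hasFDerivAt_const u z)).clm_apply (hasFDerivAt_const v z)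
  have hξ : HasFDerivAt (fun z : V × W => ξ z.1) (ξ ∘L ContinuousLinearMap.fst ℝ V W) z :=
    ξ.hasFDerivAt.comp z hasFDerivAt_fst
  have hφd : HasDerivAt φ (deriv φ (ξ z.1)) (ξ z.1) :=
    (hφ.differentiable (by simp) _).hasDerivAt
  have hfd : HasDerivAt f (deriv f (ξ z.1)) (ξ z.1) :=
    (hf.differentiable (by simp) _).hasDerivAt
  have hKd : HasFDerivAt (fun z : V × W => K z.2) _ z :=
    (hK.differentiableAt (by simp)).hasFDerivAt.comp z hasFDerivAt_snd
  have ha := (((hφd.pow 2).inv (pow_ne_zero 2 hφ')).comp_hasFDerivAt z hξ).mul_const (A u.1 v.1)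
  have hb := ((hfd.pow 2).comp_hasFDerivAt z hξ).mul
    ((hKd.clm_apply (hasFDerivAt_const u.2 z)).clm_apply (hasFDerivAt_const v.2 z))
  have := congrArg (fun T : V × W →L[ℝ] ℝ => T w) (h1.unique (ha.add hb))
  simp at this
  rw [this]
  field_simp
  ring

/-- The Christoffel map of the warped product `φ(ξ)⁻² A + f(ξ)² K`, where `N` is the gradient of `ξ`
with respect to `A`. -/
theorem christoffel_warpedForm [FiniteDimensional ℝ V] [FiniteDimensional ℝ W] {z : V × W} {N : V}
    (hφ : ContDiff ℝ ∞ φ) (hf : ContDiff ℝ ∞ f)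
    (hφ0 : ∀ t, 0 < φ t) (hf0 : ∀ t, 0 < f t)
    (hA : ∀ u, (∀ v, A u v = 0) → u = 0) (hN : ∀ v, A N v = ξ v)
    (hK : ContDiffAt ℝ ∞ K z.2) (hKn : ∀ u, (∀ v, K z.2 u v = 0) → u = 0) (u v : V × W) :
    christoffel (warpedForm φ f ξ A K) z u v =
      (-(deriv φ (ξ z.1) / φ (ξ z.1)) • (ξ u.1 • v.1 + ξ v.1 • u.1 - A u.1 v.1 • N) -
          (f (ξ z.1) * deriv f (ξ z.1) * φ (ξ z.1) ^ 2) • K z.2 u.2 v.2 • N,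
        (deriv f (ξ z.1) / f (ξ z.1)) • (ξ u.1 • v.2 + ξ v.1 • u.2) +
          christoffel K z.2 u.2 v.2) := by
  have hφ' := (hφ0 (ξ z.1)).ne'
  have hf' := (hf0 (ξ z.1)).ne'
  rw [christoffel_eq_iff (warpedForm_nondegenerate hφ0 hf0 hA hKn)]
  intro w
  have hΓ : K z.2 (christoffel K z.2 u.2 v.2) w.2 = koszulForm K z.2 u.2 v.2 w.2 :=
    ((christoffel_eq_iff hKn).1 rfl w.2).symm
  rw [koszulForm_apply] at hΓ ⊢
  simp only [fderiv_warpedForm hφ hf hφ0 hK, warpedForm_apply, map_add, map_sub, map_smul,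
    add_apply, sub_apply, smul_apply, smul_eq_mul, hN, hΓ]
  field_simp
  ring

end WarpedForm

/-! ### Curvature and Hessian of a warped form -/

section WarpedCurvature

variable {V : Type*} [NormedAddCommGroup V] [NormedSpace ℝ V] [FiniteDimensional ℝ V]
  {W : Type*} [NormedAddCommGroup W] [NormedSpace ℝ W] [FiniteDimensional ℝ W]
  {φ f : ℝ → ℝ} {ξ : V →L[ℝ] ℝ} {A : V →L[ℝ] V →L[ℝ] ℝ} {K : W → W →L[ℝ] W →L[ℝ] ℝ}

theorem differentiable_logDeriv_of_contDiff {φ : ℝ → ℝ} (hφ : ContDiff ℝ ∞ φ)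
    (hφ0 : ∀ t, 0 < φ t) : Differentiable ℝ fun t => deriv φ t / φ t := by
  have h1 : Differentiable ℝ (deriv φ) :=
    (contDiff_infty_iff_deriv.1 hφ).2.differentiable (by simp)
  exact h1.div (hφ.differentiable (by simp)) fun t => (hφ0 t).ne'

/-- The derivative of the Christoffel map of the warped product, obtained by differentiating
`christoffel_warpedForm`. -/
theorem fderiv_christoffel_warpedForm {z : V × W} {N : V} {S : Set W} (hS : IsOpen S)
    (hz : z.2 ∈ S) (hφ : ContDiff ℝ ∞ φ) (hf : ContDiff ℝ ∞ f)
    (hφ0 : ∀ t, 0 < φ t) (hf0 : ∀ t, 0 < f t)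
    (hA : ∀ u, (∀ v, A u v = 0) → u = 0) (hN : ∀ v, A N v = ξ v)
    (hK : ContDiffOn ℝ ∞ K S) (hKn : ∀ y ∈ S, ∀ u, (∀ v, K y u v = 0) → u = 0)
    (w u v : V × W) :
    fderiv ℝ (christoffel (warpedForm φ f ξ A K)) z w u v =
      ((-deriv (fun t => deriv φ t / φ t) (ξ z.1) * ξ w.1) •
            (ξ u.1 • v.1 + ξ v.1 • u.1 - A u.1 v.1 • N) -
          (deriv (fun t => f t * deriv f t * φ t ^ 2) (ξ z.1) * ξ w.1 * K z.2 u.2 v.2 +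
            f (ξ z.1) * deriv f (ξ z.1) * φ (ξ z.1) ^ 2 * fderiv ℝ K z.2 w.2 u.2 v.2) • N,
        (deriv (fun t => deriv f t / f t) (ξ z.1) * ξ w.1) • (ξ u.1 • v.2 + ξ v.1 • u.2) +
          fderiv ℝ (christoffel K) z.2 w.2 u.2 v.2) := by
  have hKz : ContDiffAt ℝ ∞ K z.2 := hK.contDiffAt (hS.mem_nhds hz)
  have hd : HasFDerivAt (christoffel (warpedForm φ f ξ A K)) _ z :=
    ((contDiffAt_christoffel (contDiffAt_warpedForm hφ hf hφ0 hKz)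
      (warpedForm_nondegenerate hφ0 hf0 hA (hKn _ hz))).differentiableAt (by simp)).hasFDerivAt
  have h1 := (hd.clm_apply (hasFDerivAt_const u z)).clm_apply (hasFDerivAt_const v z)
  have hξ : HasFDerivAt (fun z : V × W => ξ z.1) (ξ ∘L ContinuousLinearMap.fst ℝ V W) z :=
    ξ.hasFDerivAt.comp z hasFDerivAt_fst
  have hp := ((differentiable_logDeriv_of_contDiff hφ hφ0 (ξ z.1)).hasDerivAt.neg).comp_hasFDerivAt
    z hξ
  have hq := ((differentiable_logDeriv_of_contDiff hf hf0 (ξ z.1)).hasDerivAt).comp_hasFDerivAt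
    z hξ
  have hr0 : Differentiable ℝ fun t => f t * deriv f t * φ t ^ 2 :=
    ((hf.differentiable (by simp)).mul
      ((contDiff_infty_iff_deriv.1 hf).2.differentiable (by simp))).mul
      ((hφ.differentiable (by simp)).pow 2)
  have hr := ((hr0 (ξ z.1)).hasDerivAt).comp_hasFDerivAt z hξ
  have hKd : HasFDerivAt (fun z : V × W => K z.2) _ z :=
    (hKz.differentiableAt (by simp)).hasFDerivAt.comp z hasFDerivAt_snd
  have hKd' := (hKd.clm_apply (hasFDerivAt_const u.2 z)).clm_apply (hasFDerivAt_const v.2 z)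
  have hΓ : HasFDerivAt (fun z : V × W => christoffel K z.2) _ z :=
    ((contDiffAt_christoffel hKz (hKn _ hz)).differentiableAt (by simp)).hasFDerivAt.comp z
      hasFDerivAt_snd
  have hΓ' := (hΓ.clm_apply (hasFDerivAt_const u.2 z)).clm_apply (hasFDerivAt_const v.2 z)
  have hfst := (hp.smul_const (ξ u.1 • v.1 + ξ v.1 • u.1 - A u.1 v.1 • N)).sub
    ((hr.mul hKd').smul_const N)
  have hsnd := (hq.smul_const (ξ u.1 • v.2 + ξ v.1 • u.2)).add hΓ'
  have h2 := (hfst.prodMk hsnd).congr_of_eventuallyEq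
    (f₁ := fun z' => christoffel (warpedForm φ f ξ A K) z' u v) (by
      filter_upwards [(hS.preimage continuous_snd).mem_nhds hz] with z' hz'
      rw [christoffel_warpedForm hφ hf hφ0 hf0 hA hN (hK.contDiffAt (hS.mem_nhds hz'))
        (hKn _ hz') u v]
      simp [mul_smul])
  have := congrArg (fun T : V × W →L[ℝ] V × W => T w) (h1.unique h2)
  simp at this
  rw [this]
  refine Prod.ext ?_ ?_ <;> simp
  module

/-- The Ricci tensor of the warped product `φ(ξ)⁻² A + f(ξ)² K` when `ξ` is null, that is, when the
gradient `N` of `ξ` lies in the kernel of `ξ`: besides the Ricci tensor of the fibre there is only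
a multiple of `ξ ⊗ ξ`. -/
theorem coordRicci_warpedForm {z : V × W} {N : V} {S : Set W} (hS : IsOpen S)
    (hz : z.2 ∈ S) (hφ : ContDiff ℝ ∞ φ) (hf : ContDiff ℝ ∞ f)
    (hφ0 : ∀ t, 0 < φ t) (hf0 : ∀ t, 0 < f t)
    (hA : ∀ u, (∀ v, A u v = 0) → u = 0) (hAs : ∀ u v, A u v = A v u)
    (hN : ∀ v, A N v = ξ v) (hnull : ξ N = 0)
    (hK : ContDiffOn ℝ ∞ K S) (hKs : ∀ y ∈ S, ∀ u v, K y u v = K y v u)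
    (hKn : ∀ y ∈ S, ∀ u, (∀ v, K y u v = 0) → u = 0)
    (v w : V × W) :
    coordRicci (warpedForm φ f ξ A K) z v w =
      (((Module.finrank ℝ V : ℝ) - 2) *
          (deriv (fun t => deriv φ t / φ t) (ξ z.1) + (deriv φ (ξ z.1) / φ (ξ z.1)) ^ 2) -
        (Module.finrank ℝ W : ℝ) *
          (deriv (fun t => deriv f t / f t) (ξ z.1) +
            2 * (deriv φ (ξ z.1) / φ (ξ z.1)) * (deriv f (ξ z.1) / f (ξ z.1)) +
            (deriv f (ξ z.1) / f (ξ z.1)) ^ 2)) * (ξ v.1 * ξ w.1) +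
      coordRicci K z.2 v.2 w.2 := by
  have hKz : ContDiffAt ℝ ∞ K z.2 := hK.contDiffAt (hS.mem_nhds hz)
  have hΓs := christoffel_symm (hKz.differentiableAt (by simp))
    (Filter.eventually_of_mem (hS.mem_nhds hz) hKs)
  have hAN : ∀ u, A u N = ξ u := fun u => by rw [hAs, hN]
  have hΓ := christoffel_warpedForm hφ hf hφ0 hf0 hA hN hKz (hKn _ hz)
  have hdΓ := fderiv_christoffel_warpedForm hS hz hφ hf hφ0 hf0 hA hN hK hKn
  rw [coordRicci, LinearMap.trace_prod_eq_add]
  set p := deriv φ (ξ z.1) / φ (ξ z.1)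
  set q := deriv f (ξ z.1) / f (ξ z.1)
  set r := f (ξ z.1) * deriv f (ξ z.1) * φ (ξ z.1) ^ 2
  set p' := deriv (fun t => deriv φ t / φ t) (ξ z.1)
  set q' := deriv (fun t => deriv f t / f t) (ξ z.1)
  set r' := deriv (fun t => f t * deriv f t * φ t ^ 2) (ξ z.1)
  clear_value p q r p' q' r'
  -- On the base block the curvature is a combination of the identity, of a map `u ↦ ξ u • Z`
  -- and of a map `u ↦ A u c • N`, whose traces are `dim V`, `ξ Z` and `ξ c`.
  have hbase : LinearMap.fst ℝ V W ∘ₗ coordCurvature (warpedForm φ f ξ A K) z v w ∘ₗ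
      LinearMap.inl ℝ V W =
      ((p' + p ^ 2) * (ξ v.1 * ξ w.1)) • LinearMap.id +
      (ξ : V →ₗ[ℝ] ℝ).smulRight
        ((-p' - p ^ 2) • (ξ w.1 • v.1 - A v.1 w.1 • N) -
          (r' * K z.2 v.2 w.2) • N + (q * r) • K z.2 v.2 w.2 • N) +
      (A.flip ((-p' - p ^ 2) • ξ v.1 • w.1) : V →ₗ[ℝ] ℝ).smulRight N := by
    refine LinearMap.ext fun u => ?_
    simp [coordCurvature, hΓ, hdΓ, hAN, hnull, hAs v.1 u]
    module
  have hfibre : LinearMap.snd ℝ V W ∘ₗ coordCurvature (warpedForm φ f ξ A K) z v w ∘ₗ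
      LinearMap.inr ℝ V W =
      (-(q' + 2 * p * q + q ^ 2) * (ξ v.1 * ξ w.1)) • LinearMap.id +
      coordCurvature K z.2 v.2 w.2 := by
    refine LinearMap.ext fun u => ?_
    simp [coordCurvature, hΓ, hdΓ, hAN, hnull, hΓs v.2 u]
    module
  rw [hbase, hfibre]
  simp only [map_add, map_smul, LinearMap.trace_smulRight, LinearMap.trace_id]
  simp [coordRicci, hnull, hN]
  ring

theorem coordHessian_warpedForm {h : ℝ → ℝ} {z : V × W} {N : V}
    (hφ : ContDiff ℝ ∞ φ) (hf : ContDiff ℝ ∞ f) (hh : ContDiff ℝ ∞ h)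
    (hφ0 : ∀ t, 0 < φ t) (hf0 : ∀ t, 0 < f t)
    (hA : ∀ u, (∀ v, A u v = 0) → u = 0)
    (hN : ∀ v, A N v = ξ v) (hnull : ξ N = 0)
    (hK : ContDiffAt ℝ ∞ K z.2) (hKn : ∀ u, (∀ v, K z.2 u v = 0) → u = 0) (u v : V × W) :
    coordHessian (warpedForm φ f ξ A K) (fun z => h (ξ z.1)) z u v =
      (deriv (deriv h) (ξ z.1) + 2 * (deriv φ (ξ z.1) / φ (ξ z.1)) * deriv h (ξ z.1)) *
        (ξ u.1 * ξ v.1) := by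
  have hξ : ∀ z : V × W,
      HasFDerivAt (fun z : V × W => ξ z.1) (ξ ∘L ContinuousLinearMap.fst ℝ V W) z :=
    fun z => ξ.hasFDerivAt.comp z hasFDerivAt_fst
  have h1 : fderiv ℝ (fun z : V × W => h (ξ z.1)) =
      fun z => deriv h (ξ z.1) • (ξ ∘L ContinuousLinearMap.fst ℝ V W) := by
    funext z
    exact ((hh.differentiable (by simp) _).hasDerivAt.comp_hasFDerivAt z (hξ z)).fderiv
  have hd : Differentiable ℝ (deriv h) :=
    (contDiff_infty_iff_deriv.1 hh).2.differentiable (by simp)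
  have h2 := (((hd (ξ z.1)).hasDerivAt.comp_hasFDerivAt z (hξ z)).smul_const
    (ξ ∘L ContinuousLinearMap.fst ℝ V W)).fderiv
  rw [coordHessian, h1, christoffel_warpedForm hφ hf hφ0 hf0 hA hN hK hKn]
  simp only [Function.comp_def] at h2
  rw [h2]
  simp [hnull]
  ring

end WarpedCurvature

/-! ### Warped product metrics in charts -/

section Charts

variable {E : Type*} [NormedAddCommGroup E] [NormedSpace ℝ E]
  {H : Type*} [TopologicalSpace H] {I : ModelWithCorners ℝ E H}
  {M : Type*} [TopologicalSpace M] [ChartedSpace H M]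

theorem BilinField.inChart_apply (g : BilinField I M) (p : M) (y u v : E) :
    g.inChart p y u v = g ((extChartAt I p).symm y)
      (mfderiv 𝓘(ℝ, E) I (extChartAt I p).symm y u)
      (mfderiv 𝓘(ℝ, E) I (extChartAt I p).symm y v) := rfl

theorem IsSemiRiemannianMetric.inChart_symm {g : BilinField I M} (hg : IsSemiRiemannianMetric g)
    (p : M) (y u v : E) : g.inChart p y u v = g.inChart p y v u :=
  hg.symm _ _ _

variable [I.Boundaryless] [IsManifold I ∞ M]

theorem isInvertible_mfderiv_symm_extChartAt {p : M} {y : E} (hy : y ∈ (extChartAt I p).target) :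
    (mfderiv 𝓘(ℝ, E) I (extChartAt I p).symm y).IsInvertible := by
  have : IsManifold I 1 M := .of_le (n := ∞) (by simp)
  have h := isInvertible_mfderivWithin_extChartAt_symm hy
  rwa [I.range_eq_univ, mfderivWithin_univ] at h

theorem mdifferentiableAt_symm_extChartAt {p : M} {y : E} (hy : y ∈ (extChartAt I p).target) :
    MDifferentiableAt 𝓘(ℝ, E) I (extChartAt I p).symm y := by
  have : IsManifold I 1 M := .of_le (n := ∞) (by simp)
  have h := mdifferentiableWithinAt_extChartAt_symm (I := I) hy
  rwa [I.range_eq_univ, mdifferentiableWithinAt_univ] at h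

theorem IsSemiRiemannianMetric.inChart_nondegenerate {g : BilinField I M}
    (hg : IsSemiRiemannianMetric g) {p : M} {y : E} (hy : y ∈ (extChartAt I p).target) (u : E)
    (hu : ∀ v, g.inChart p y u v = 0) : u = 0 := by
  have hbij := (isInvertible_mfderiv_symm_extChartAt (I := I) hy).bijective
  refine hbij.1 (Eq.trans (hg.nondegenerate _ _ fun v => ?_) (map_zero _).symm)
  obtain ⟨v', rfl⟩ := hbij.2 v
  exact hu v'

end Charts

section XiWarped

variable {n m : ℕ} {F : Type*} [TopologicalSpace F] [ChartedSpace (EuclideanSpace ℝ (Fin m)) F]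

/-- The form `∑ i, ε_i dx_i²` on the vector space `ℝⁿ`. -/
def diagonalForm (ε : Fin n → ℝ) :
    EuclideanSpace ℝ (Fin n) →L[ℝ] EuclideanSpace ℝ (Fin n) →L[ℝ] ℝ :=
  ∑ i, ε i • (EuclideanSpace.proj i : EuclideanSpace ℝ (Fin n) →L[ℝ] ℝ).smulRight
    (EuclideanSpace.proj i : EuclideanSpace ℝ (Fin n) →L[ℝ] ℝ)

theorem diagonalForm_apply (ε : Fin n → ℝ) (u v : EuclideanSpace ℝ (Fin n)) :
    diagonalForm ε u v = ∑ i, ε i * (u i * v i) := by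
  simp [diagonalForm]

/-- The linear form `ξ = ∑ i, α_i x_i`. -/
def xiForm (α : Fin n → ℝ) : EuclideanSpace ℝ (Fin n) →L[ℝ] ℝ :=
  ∑ i, α i • (EuclideanSpace.proj i : EuclideanSpace ℝ (Fin n) →L[ℝ] ℝ)

theorem xiForm_apply (α : Fin n → ℝ) (x : EuclideanSpace ℝ (Fin n)) :
    xiForm α x = xiInv α x := by
  simp [xiForm, xiInv]

theorem xiWarpedMetric_apply (ε α : Fin n → ℝ) (φ f : ℝ → ℝ) (gF : BilinField (𝓡 m) F)
    (p : EuclideanSpace ℝ (Fin n) × F)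
    (u v : EuclideanSpace ℝ (Fin n) × EuclideanSpace ℝ (Fin m)) :
    xiWarpedMetric ε α φ f gF p u v =
      (φ (xiForm α p.1) ^ 2)⁻¹ * diagonalForm ε u.1 v.1 +
        f (xiForm α p.1) ^ 2 * gF p.2 u.2 v.2 := by
  simp only [xiWarpedMetric, warpedProduct, mfderiv_fst, mfderiv_snd, xiForm_apply]
  rfl

/-- A form of `xiWarpedMetric_apply` that replaces the point and the two vectors at once: with the
vectors taken in the fixed space `ℝⁿ × ℝᵐ` instead of the tangent space at `p`, no transport along
`p = p'` is needed. -/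
theorem xiWarpedMetric_apply_of_eq (ε α : Fin n → ℝ) (φ f : ℝ → ℝ) (gF : BilinField (𝓡 m) F)
    {p p' : EuclideanSpace ℝ (Fin n) × F} (hp : p = p')
    {u u' v v' : EuclideanSpace ℝ (Fin n) × EuclideanSpace ℝ (Fin m)}
    (hu : u = u') (hv : v = v') :
    xiWarpedMetric ε α φ f gF p u v =
      (φ (xiForm α p'.1) ^ 2)⁻¹ * diagonalForm ε u'.1 v'.1 +
        f (xiForm α p'.1) ^ 2 * gF p'.2 u'.2 v'.2 := by
  subst hp hu hv
  exact xiWarpedMetric_apply ε α φ f gF p u v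

theorem mfderiv_fst_prodMk_comp_snd {τ : EuclideanSpace ℝ (Fin m) → F}
    {y : EuclideanSpace ℝ (Fin n) × EuclideanSpace ℝ (Fin m)}
    (hτ : MDifferentiableAt (𝓡 m) (𝓡 m) τ y.2)
    (u : EuclideanSpace ℝ (Fin n) × EuclideanSpace ℝ (Fin m)) :
    mfderiv 𝓘(ℝ, EuclideanSpace ℝ (Fin n) × EuclideanSpace ℝ (Fin m)) ((𝓡 n).prod (𝓡 m))
      (fun y : EuclideanSpace ℝ (Fin n) × EuclideanSpace ℝ (Fin m) => (y.1, τ y.2)) y u =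
        (u.1, mfderiv (𝓡 m) (𝓡 m) τ y.2 u.2) := by
  have h1 := (hasFDerivAt_fst (𝕜 := ℝ) (p := y)).hasMFDerivAt
  have h2 := hτ.hasMFDerivAt.comp y (hasFDerivAt_snd (𝕜 := ℝ) (p := y)).hasMFDerivAt
  have hd := (h1.prodMk h2).mfderiv
  exact congrArg (fun D : EuclideanSpace ℝ (Fin n) × EuclideanSpace ℝ (Fin m) →L[ℝ]
    EuclideanSpace ℝ (Fin n) × EuclideanSpace ℝ (Fin m) => D u) hd

/-- In the product chart, the warped product metric is the warped form built on the coordinate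
expression of the fibre metric. -/
theorem xiWarpedMetric_inChart (ε α : Fin n → ℝ) (φ f : ℝ → ℝ) (gF : BilinField (𝓡 m) F)
    [IsManifold (𝓡 m) ∞ F] (p : EuclideanSpace ℝ (Fin n) × F)
    {y : EuclideanSpace ℝ (Fin n) × EuclideanSpace ℝ (Fin m)}
    (hy : y.2 ∈ (extChartAt (𝓡 m) p.2).target) :
    (xiWarpedMetric ε α φ f gF).inChart p y =
      warpedForm φ f (xiForm α) (diagonalForm ε) (gF.inChart p.2) y := by
  have hsymm : ((extChartAt ((𝓡 n).prod (𝓡 m)) p).symm :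
      EuclideanSpace ℝ (Fin n) × EuclideanSpace ℝ (Fin m) → EuclideanSpace ℝ (Fin n) × F) =
      fun y => (y.1, (extChartAt (𝓡 m) p.2).symm y.2) := by
    rw [extChartAt_prod, extChartAt_model_space_eq_id]
    rfl
  have hτ := mdifferentiableAt_symm_extChartAt hy
  have hD : ∀ u : EuclideanSpace ℝ (Fin n) × EuclideanSpace ℝ (Fin m),
      mfderiv 𝓘(ℝ, EuclideanSpace ℝ (Fin n) × EuclideanSpace ℝ (Fin m)) ((𝓡 n).prod (𝓡 m))
        (extChartAt ((𝓡 n).prod (𝓡 m)) p).symm y u =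
      (u.1, mfderiv (𝓡 m) (𝓡 m) (extChartAt (𝓡 m) p.2).symm y.2 u.2) := by
    rw [hsymm]
    exact mfderiv_fst_prodMk_comp_snd hτ
  have hp := congrFun hsymm y
  refine ContinuousLinearMap.ext fun u => ContinuousLinearMap.ext fun v => ?_
  have h1 := BilinField.inChart_apply (xiWarpedMetric ε α φ f gF) p y u v
  rw [h1, xiWarpedMetric_apply_of_eq ε α φ f gF hp (hD u) (hD v)]
  rfl

end XiWarped

/-! ### The soliton equation -/

section Soliton

variable {n m : ℕ} {ε α : Fin n → ℝ} {φ f h : ℝ → ℝ}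

theorem diagonalForm_symm (u v : EuclideanSpace ℝ (Fin n)) :
    diagonalForm ε u v = diagonalForm ε v u := by
  simp only [diagonalForm_apply, mul_comm]

theorem diagonalForm_nondegenerate (hε : ∀ i, ε i = 1 ∨ ε i = -1) (u : EuclideanSpace ℝ (Fin n))
    (hu : ∀ v, diagonalForm ε u v = 0) : u = 0 := by
  ext i
  have := hu (EuclideanSpace.single i 1)
  rw [diagonalForm_apply, Finset.sum_eq_single i (by simp +contextual) (by simp)] at this
  rcases hε i with h | h <;> simpa [h] using this

/-- The gradient `(ε_i α_i)` of `ξ` with respect to `∑ i, ε_i dx_i²`. -/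
def xiGradient (ε α : Fin n → ℝ) : EuclideanSpace ℝ (Fin n) := WithLp.toLp 2 fun i => ε i * α i

theorem diagonalForm_xiGradient (hε : ∀ i, ε i = 1 ∨ ε i = -1) (v : EuclideanSpace ℝ (Fin n)) :
    diagonalForm ε (xiGradient ε α) v = xiForm α v := by
  rw [diagonalForm_apply, xiForm_apply, xiInv]
  refine Finset.sum_congr rfl fun i _ => ?_
  rcases hε i with h | h <;> simp [xiGradient, h]

theorem xiForm_xiGradient : xiForm α (xiGradient ε α) = ∑ i, ε i * α i ^ 2 := by
  rw [xiForm_apply, xiInv]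
  refine Finset.sum_congr rfl fun i _ => ?_
  simp only [xiGradient]
  ring

variable {F : Type*} [TopologicalSpace F] [ChartedSpace (EuclideanSpace ℝ (Fin m)) F]
  {gF : BilinField (𝓡 m) F}

theorem snd_mem_target_of_mem_target {p : EuclideanSpace ℝ (Fin n) × F}
    {y : EuclideanSpace ℝ (Fin n) × EuclideanSpace ℝ (Fin m)}
    (hy : y ∈ (extChartAt ((𝓡 n).prod (𝓡 m)) p).target) :
    y.2 ∈ (extChartAt (𝓡 m) p.2).target := by
  rw [extChartAt_prod, PartialEquiv.prod_target] at hy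
  exact hy.2

theorem xiWarpedMetric_apply_base (ε α : Fin n → ℝ) (φ f : ℝ → ℝ) (gF : BilinField (𝓡 m) F)
    (p : EuclideanSpace ℝ (Fin n) × F)
    (u : EuclideanSpace ℝ (Fin n) × EuclideanSpace ℝ (Fin m)) (v : EuclideanSpace ℝ (Fin n)) :
    xiWarpedMetric ε α φ f gF p u ((v, 0) : EuclideanSpace ℝ (Fin n) × EuclideanSpace ℝ (Fin m)) =
      (φ (xiForm α p.1) ^ 2)⁻¹ * diagonalForm ε u.1 v := by
  have h0 : gF p.2 u.2 0 = 0 := map_zero _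
  refine (xiWarpedMetric_apply ε α φ f gF p u (v, 0)).trans ((congrArg (fun c =>
    (φ (xiForm α p.1) ^ 2)⁻¹ * diagonalForm ε u.1 v + f (xiForm α p.1) ^ 2 * c) h0).trans ?_)
  ring

theorem isSemiRiemannianMetric_xiWarpedMetric [IsManifold (𝓡 m) ∞ F]
    (hε : ∀ i, ε i = 1 ∨ ε i = -1) (hφ : ContDiff ℝ ∞ φ) (hf : ContDiff ℝ ∞ f)
    (hφ0 : ∀ t, 0 < φ t) (hf0 : ∀ t, 0 < f t) (hgF : IsSemiRiemannianMetric gF) :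
    IsSemiRiemannianMetric (xiWarpedMetric ε α φ f gF) where
  symm p u v := by
    refine (xiWarpedMetric_apply ε α φ f gF p u v).trans (Eq.trans ?_
      (xiWarpedMetric_apply ε α φ f gF p v u).symm)
    exact congrArg₂ (· + ·) (congrArg _ (diagonalForm_symm _ _))
      (congrArg _ (hgF.symm p.2 _ _))
  nondegenerate p u hu := by
    have hφ' := (hφ0 (xiForm α p.1)).ne'
    have hf' := (hf0 (xiForm α p.1)).ne'
    refine Prod.ext (diagonalForm_nondegenerate hε _ fun v => ?_)
      (hgF.nondegenerate p.2 _ fun v => ?_)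
    · have := (xiWarpedMetric_apply_base ε α φ f gF p u v).symm.trans (hu _)
      simpa [hφ'] using this
    · have := (xiWarpedMetric_apply ε α φ f gF p u (0, v)).symm.trans (hu _)
      simpa [hf'] using this
  smooth p := by
    have h2 : ContDiffOn ℝ ∞ (warpedForm φ f (xiForm α) (diagonalForm ε) (gF.inChart p.2))
        (extChartAt ((𝓡 n).prod (𝓡 m)) p).target := fun y hy =>
      (contDiffAt_warpedForm hφ hf hφ0 ((hgF.smooth p.2).contDiffAt
        ((isOpen_extChartAt_target p.2).mem_nhds
          (snd_mem_target_of_mem_target hy)))).contDiffWithinAt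
    exact h2.congr fun y hy =>
      xiWarpedMetric_inChart ε α φ f gF p (snd_mem_target_of_mem_target hy)

theorem deriv_logDeriv_add_sq {f : ℝ → ℝ} (hf : ContDiff ℝ ∞ f) (hf0 : ∀ t, 0 < f t) (t : ℝ) :
    deriv (fun t => deriv f t / f t) t + (deriv f t / f t) ^ 2 = deriv (deriv f) t / f t := by
  have hf' := (hf0 t).ne'
  rw [deriv_fun_div ((contDiff_infty_iff_deriv.1 hf).2.differentiable (by simp) t)
    (hf.differentiable (by simp) t) hf']
  field_simp
  ring

theorem extChartAt_prod_apply_self (p : EuclideanSpace ℝ (Fin n) × F) :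
    extChartAt ((𝓡 n).prod (𝓡 m)) p p = (p.1, extChartAt (𝓡 m) p.2 p.2) := by
  rw [extChartAt_prod, extChartAt_model_space_eq_id]
  rfl

variable [IsManifold (𝓡 m) ∞ F]

theorem xiWarpedMetric_inChart_eventuallyEq (ε α : Fin n → ℝ) (φ f : ℝ → ℝ)
    (gF : BilinField (𝓡 m) F) (p : EuclideanSpace ℝ (Fin n) × F) :
    (xiWarpedMetric ε α φ f gF).inChart p =ᶠ[nhds (p.1, extChartAt (𝓡 m) p.2 p.2)]
      warpedForm φ f (xiForm α) (diagonalForm ε) (gF.inChart p.2) := by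
  filter_upwards [((isOpen_extChartAt_target (I := 𝓡 m) p.2).preimage continuous_snd).mem_nhds
    (mem_extChartAt_target (I := 𝓡 m) p.2)] with y hy
  exact xiWarpedMetric_inChart ε α φ f gF p hy

theorem ricci_xiWarpedMetric (hε : ∀ i, ε i = 1 ∨ ε i = -1) (hα : ∑ i, ε i * α i ^ 2 = 0)
    (hφ : ContDiff ℝ ∞ φ) (hf : ContDiff ℝ ∞ f)
    (hφ0 : ∀ t, 0 < φ t) (hf0 : ∀ t, 0 < f t)
    (hgF : IsSemiRiemannianMetric gF) (p : EuclideanSpace ℝ (Fin n) × F)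
    (u v : EuclideanSpace ℝ (Fin n) × EuclideanSpace ℝ (Fin m)) :
    ricci (xiWarpedMetric ε α φ f gF) p u v =
      (((n : ℝ) - 2) * (deriv (deriv φ) (xiForm α p.1) / φ (xiForm α p.1)) -
        m * (deriv (deriv f) (xiForm α p.1) / f (xiForm α p.1) +
          2 * (deriv φ (xiForm α p.1) / φ (xiForm α p.1)) *
            (deriv f (xiForm α p.1) / f (xiForm α p.1)))) * (xiForm α u.1 * xiForm α v.1) +
      ricci gF p.2 u.2 v.2 := by
  have hric := (coordRicci_congr (xiWarpedMetric_inChart_eventuallyEq ε α φ f gF p) u v).trans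
    (coordRicci_warpedForm (isOpen_extChartAt_target p.2) (mem_extChartAt_target p.2)
      hφ hf hφ0 hf0 (diagonalForm_nondegenerate hε) diagonalForm_symm
      (diagonalForm_xiGradient hε) (xiForm_xiGradient.trans hα) (hgF.smooth p.2)
      (fun y _ => hgF.inChart_symm p.2 y) (fun _ hy => hgF.inChart_nondegenerate hy) u v)
  unfold ricci
  rw [extChartAt_prod_apply_self, hric]
  simp only [finrank_euclideanSpace, Fintype.card_fin]
  rw [← deriv_logDeriv_add_sq hφ hφ0, ← deriv_logDeriv_add_sq hf hf0]
  ring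

theorem hessian_xiWarpedMetric (hε : ∀ i, ε i = 1 ∨ ε i = -1) (hα : ∑ i, ε i * α i ^ 2 = 0)
    (hφ : ContDiff ℝ ∞ φ) (hf : ContDiff ℝ ∞ f) (hh : ContDiff ℝ ∞ h)
    (hφ0 : ∀ t, 0 < φ t) (hf0 : ∀ t, 0 < f t)
    (hgF : IsSemiRiemannianMetric gF) (p : EuclideanSpace ℝ (Fin n) × F)
    (u v : EuclideanSpace ℝ (Fin n) × EuclideanSpace ℝ (Fin m)) :
    hessian (xiWarpedMetric ε α φ f gF)
        (fun p : EuclideanSpace ℝ (Fin n) × F => h (xiInv α p.1)) p u v =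
      (deriv (deriv h) (xiForm α p.1) +
        2 * (deriv φ (xiForm α p.1) / φ (xiForm α p.1)) * deriv h (xiForm α p.1)) *
          (xiForm α u.1 * xiForm α v.1) := by
  have hk : (fun p : EuclideanSpace ℝ (Fin n) × F => h (xiInv α p.1)) ∘
      (extChartAt ((𝓡 n).prod (𝓡 m)) p).symm = fun y => h (xiForm α y.1) := by
    rw [extChartAt_prod, extChartAt_model_space_eq_id]
    funext y
    simp [xiForm_apply]
  have hz := mem_extChartAt_target (I := 𝓡 m) p.2
  unfold hessian
  rw [extChartAt_prod_apply_self, hk]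
  exact (coordHessian_congr (xiWarpedMetric_inChart_eventuallyEq ε α φ f gF p) _ u v).trans
    (coordHessian_warpedForm hφ hf hh hφ0 hf0 (diagonalForm_nondegenerate hε)
      (diagonalForm_xiGradient hε) (xiForm_xiGradient.trans hα)
      ((hgF.smooth p.2).contDiffAt ((isOpen_extChartAt_target p.2).mem_nhds hz))
      (hgF.inChart_nondegenerate hz) u v)

/-- If the fibre is Ricci-flat and `ξ` is null, then `Ric + Hess h` is a multiple of `ξ ⊗ ξ`, and
the differential equation says that the factor vanishes. -/
theorem isSteadyGradientRicciSoliton_xiWarpedMetric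
    (hε : ∀ i, ε i = 1 ∨ ε i = -1) (hα : ∑ i, ε i * α i ^ 2 = 0)
    (hφ : ContDiff ℝ ∞ φ) (hf : ContDiff ℝ ∞ f) (hh : ContDiff ℝ ∞ h)
    (hφ0 : ∀ t, 0 < φ t) (hf0 : ∀ t, 0 < f t) (hode : NullSolitonODE n m φ f h)
    (hgF : IsSemiRiemannianMetric gF) (hflat : IsRicciFlat gF) :
    IsSteadyGradientRicciSoliton (xiWarpedMetric ε α φ f gF)
      (fun p : EuclideanSpace ℝ (Fin n) × F => h (xiInv α p.1)) where
  metric := isSemiRiemannianMetric_xiWarpedMetric hε hφ hf hφ0 hf0 hgF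
  smooth := by
    have h1 : ContDiff ℝ ∞ fun x : EuclideanSpace ℝ (Fin n) => h (xiInv α x) := by
      simp only [← xiForm_apply]
      exact hh.comp (xiForm α).contDiff
    exact h1.contMDiff.comp contMDiff_fst
  equation p u v := by
    refine (congrArg₂ (· + ·) ((ricci_xiWarpedMetric hε hα hφ hf hφ0 hf0 hgF p u v).trans
      (congrArg _ (hflat p.2 _ _)))
      (hessian_xiWarpedMetric hε hα hφ hf hh hφ0 hf0 hgF p u v)).trans ?_
    have hode' := hode (xiForm α p.1)
    have hφ' := (hφ0 (xiForm α p.1)).ne'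
    have hf' := (hf0 (xiForm α p.1)).ne'
    rw [zero_mul, add_zero]
    refine (add_mul _ _ _).symm.trans (mul_eq_zero_of_left ?_ _)
    field_simp
    linear_combination hode'

theorem hasDerivAt_integral_of_continuous {g : ℝ → ℝ} (hg : Continuous g) (a t : ℝ) :
    HasDerivAt (fun t => ∫ s in a..t, g s) (g t) t :=
  intervalIntegral.integral_hasDerivAt_right (hg.intervalIntegrable _ _)
    (hg.stronglyMeasurableAtFilter _ _) hg.continuousAt

theorem contDiff_integral {g : ℝ → ℝ} (hg : ContDiff ℝ ∞ g) (a : ℝ) :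
    ContDiff ℝ ∞ fun t => ∫ s in a..t, g s := by
  have h := hasDerivAt_integral_of_continuous hg.continuous a
  refine contDiff_infty_iff_deriv.2 ⟨fun t => (h t).differentiableAt, ?_⟩
  rwa [show deriv (fun t => ∫ s in a..t, g s) = g from funext fun t => (h t).deriv]

/-- The double-integral formula solves the equation: multiplied by `φ / f`, the equation reads
`(φ² h')' = m (f'' / f) φ² + 2 m φ φ' f' / f - (n - 2) φ φ''`. -/
theorem nullPotential_contDiff_and_ode (n m : ℕ) (hφ : ContDiff ℝ ∞ φ) (hf : ContDiff ℝ ∞ f)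
    (hφ0 : ∀ t, 0 < φ t) (hf0 : ∀ t, 0 < f t) (a b c₄ c₅ : ℝ) :
    ContDiff ℝ ∞ (nullPotential n m φ f a b c₄ c₅) ∧
      NullSolitonODE n m φ f (nullPotential n m φ f a b c₄ c₅) := by
  have hφd := (contDiff_infty_iff_deriv.1 hφ).2
  have hφdd := (contDiff_infty_iff_deriv.1 hφd).2
  have hfd := (contDiff_infty_iff_deriv.1 hf).2
  have hfdd := (contDiff_infty_iff_deriv.1 hfd).2
  set J : ℝ → ℝ := fun r => m * (deriv (deriv f) r / f r) * φ r ^ 2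
        + 2 * m * φ r * deriv φ r * (deriv f r / f r)
        - ((n : ℝ) - 2) * φ r * deriv (deriv φ) r with hJ
  have hJs : ContDiff ℝ ∞ J :=
    (((contDiff_const.mul (hfdd.div hf fun t => (hf0 t).ne')).mul (hφ.pow 2)).add
      (((contDiff_const.mul hφ).mul hφd).mul (hfd.div hf fun t => (hf0 t).ne'))).sub
      ((contDiff_const.mul hφ).mul hφdd)
  set g : ℝ → ℝ := fun s => (φ s ^ 2)⁻¹ * ((∫ r in a..s, J r) + c₄) with hg
  have hgs : ContDiff ℝ ∞ g :=
    ((hφ.pow 2).inv fun t => (pow_pos (hφ0 t) 2).ne').mul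
      ((contDiff_integral hJs a).add contDiff_const)
  have hnull : nullPotential n m φ f a b c₄ c₅ = fun t => (∫ s in b..t, g s) + c₅ := rfl
  have hd : deriv (nullPotential n m φ f a b c₄ c₅) = g := by
    rw [hnull]
    funext t
    exact ((hasDerivAt_integral_of_continuous hgs.continuous b t).add_const c₅).deriv
  refine ⟨hnull ▸ (contDiff_integral hgs b).add contDiff_const, fun t => ?_⟩
  have hφ' := (hφ0 t).ne'
  have hf' := (hf0 t).ne'
  have hgd := ((((hφ.differentiable (by simp) t).hasDerivAt).pow 2).inv (pow_ne_zero 2 hφ')).mul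
    ((hasDerivAt_integral_of_continuous hJs.continuous a t).add_const c₄)
  have hgd' : deriv g t = _ := hgd.deriv
  rw [hd, hgd']
  simp only [hg, Pi.pow_apply, Pi.inv_apply]
  generalize (∫ r in a..t, J r) + c₄ = I
  simp only [hJ]
  field_simp
  ring

end Soliton

end

theorem theorem1p7 (n m : ℕ) (hn : 3 ≤ n) (hm : 1 ≤ m)
    (ε : Fin n → ℝ) (hε : ∀ i, ε i = 1 ∨ ε i = -1)
    (α : Fin n → ℝ) (hα : ∑ i, ε i * α i ^ 2 = 0)
    (F : Type*) [TopologicalSpace F] [ChartedSpace (EuclideanSpace ℝ (Fin m)) F]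
    [IsManifold (𝓡 m) ∞ F] [Nonempty F]
    (gF : BilinField (𝓡 m) F) (hgF : IsSemiRiemannianMetric gF) (hflat : IsRicciFlat gF) :
    (∀ φ f : ℝ → ℝ, ContDiff ℝ ∞ φ → ContDiff ℝ ∞ f → (∀ t, 0 < φ t) → (∀ t, 0 < f t) →
      ∀ (a b c₄ c₅ : ℝ) (h : ℝ → ℝ), (∀ t, h t = nullPotential n m φ f a b c₄ c₅ t) →
        ContDiff ℝ ∞ h ∧ NullSolitonODE n m φ f h ∧
          IsSteadyGradientRicciSoliton (xiWarpedMetric ε α φ f gF) (fun p => h (xiInv α p.1))) ∧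
    {g : BilinField ((𝓡 n).prod (𝓡 m)) (EuclideanSpace ℝ (Fin n) × F) |
      ∃ φ f h : ℝ → ℝ, ContDiff ℝ ∞ φ ∧ ContDiff ℝ ∞ f ∧ ContDiff ℝ ∞ h ∧
        (∀ t, 0 < φ t) ∧ (∀ t, 0 < f t) ∧ g = xiWarpedMetric ε α φ f gF ∧
        IsSteadyGradientRicciSoliton g (fun p => h (xiInv α p.1))}.Infinite := by
  have main : ∀ φ f : ℝ → ℝ, ContDiff ℝ ∞ φ → ContDiff ℝ ∞ f → (∀ t, 0 < φ t) → (∀ t, 0 < f t) →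
      ∀ (a b c₄ c₅ : ℝ) (h : ℝ → ℝ), (∀ t, h t = nullPotential n m φ f a b c₄ c₅ t) →
        ContDiff ℝ ∞ h ∧ NullSolitonODE n m φ f h ∧
          IsSteadyGradientRicciSoliton (xiWarpedMetric ε α φ f gF)
            (fun p => h (xiInv α p.1)) := by
    intro φ f hφ hf hφ0 hf0 a b c₄ c₅ h hh
    obtain rfl : h = nullPotential n m φ f a b c₄ c₅ := funext hh
    obtain ⟨hs, hode⟩ := nullPotential_contDiff_and_ode n m hφ hf hφ0 hf0 a b c₄ c₅
    exact ⟨hs, hode,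
      isSteadyGradientRicciSoliton_xiWarpedMetric hε hα hφ hf hs hφ0 hf0 hode hgF hflat⟩
  refine ⟨main, ?_⟩
  -- The metrics with `φ = k + 1 + t²`, `k : ℕ`, and `f = 1 + t²` differ already at `ξ = 0`.
  refine Set.infinite_of_injective_forall_mem
    (f := fun k : ℕ => xiWarpedMetric ε α (fun t => k + 1 + t ^ 2) (fun t => 1 + t ^ 2) gF) ?_ ?_
  · intro k l hkl
    obtain ⟨q⟩ := ‹Nonempty F›
    let i : Fin n := ⟨0, by omega⟩
    have key : ∀ k : ℕ, xiWarpedMetric ε α (fun t => k + 1 + t ^ 2) (fun t => 1 + t ^ 2) gF (0, q)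
        ((EuclideanSpace.single i 1, 0) : EuclideanSpace ℝ (Fin n) × EuclideanSpace ℝ (Fin m))
        ((EuclideanSpace.single i 1, 0) : EuclideanSpace ℝ (Fin n) × EuclideanSpace ℝ (Fin m)) =
        (((k : ℝ) + 1) ^ 2)⁻¹ * ε i := by
      intro k
      refine (xiWarpedMetric_apply_base ε α _ _ gF _ _ _).trans ?_
      rw [diagonalForm_apply, Finset.sum_eq_single i (by simp +contextual) (by simp)]
      simp
    have hkl' := (key k).symm.trans ((congrArg (fun g : BilinField ((𝓡 n).prod (𝓡 m))
      (EuclideanSpace ℝ (Fin n) × F) => g (0, q)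
        ((EuclideanSpace.single i 1, 0) : EuclideanSpace ℝ (Fin n) × EuclideanSpace ℝ (Fin m))
        ((EuclideanSpace.single i 1, 0) : EuclideanSpace ℝ (Fin n) × EuclideanSpace ℝ (Fin m)))
      hkl).trans (key l))
    have hεi : ε i ≠ 0 := by rcases hε i with h | h <;> simp [h]
    have h1 := inv_injective (mul_right_cancel₀ hεi hkl')
    have h2 := (pow_left_inj₀ (by positivity) (by positivity) two_ne_zero).1 h1
    exact_mod_cast add_right_cancel h2
  · intro k
    have hφ : ContDiff ℝ ∞ fun t : ℝ => (k : ℝ) + 1 + t ^ 2 := by fun_prop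
    have hf : ContDiff ℝ ∞ fun t : ℝ => 1 + t ^ 2 := by fun_prop
    have hφ0 : ∀ t : ℝ, 0 < (k : ℝ) + 1 + t ^ 2 := fun t => by positivity
    have hf0 : ∀ t : ℝ, 0 < 1 + t ^ 2 := fun t => by positivity
    obtain ⟨hs, -, hsol⟩ := main _ _ hφ hf hφ0 hf0 0 0 0 0 _ fun _ => rfl
    exact ⟨_, _, _, hφ, hf, hs, hφ0, hf0, rfl, hsol⟩
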